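/- A \emph{drawing} $\Gamma$ of a finite simple graph $G=(V,E)$ assigns to each vertex a point of $\mathbb{R}^2$ and to each edge a simple curve in $\mathbb{R}^2$ connecting the points of its two endpoints, such that: distinct vertices have distinct points, and an edge-curve contains no vertex-point except at its two ends; if two edge-curves meet at a point that is not a common endpoint, they properly cross there; if three or more edge-curves meet in a point, it is a common endpoint of them; and the curves of two distinct edges share at most one point. The drawing is \emph{1-planar} if every edge participates in at most one crossing. A 1-planar drawing $\Gamma$ of a simple graph $G$ is \emph{simple-saturated} if there are no two distinct non-adjacent vertices $u,v$ of $G$ such that a curve for the edge $uv$ can be added to $\Gamma$ (leaving all vertices and edges of $\Gamma$ in place) so that the result is a 1-planar drawing of $G+uv$. Write $\mu(G)$ for the maximum number of edges of a matching of $G$. \textbf{Theorem.} For every $N\in\mathbb{N}$ there exist a finite simple graph $G$ with $n\ge N$ vertices and a simple-saturated 1-planar drawing of $G$ such that $$\mu(G)\le \frac{n+6}{4}.$$ -/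

import Mathlib

namespace OnePlanar

/-- `A` is a simple curve (arc) in the plane with ends `a` and `b`. -/
def IsArc (a b : ℝ × ℝ) (A : Set (ℝ × ℝ)) : Prop :=
  ∃ γ : Path a b, Function.Injective γ ∧ Set.range γ = A

/-- The curves `A` and `B` properly cross at `p`: some homeomorphism from a neighbourhood of `p`
onto an open set of the plane takes `A` to the horizontal and `B` to the vertical axis
(and hence `p` to the origin). -/
def ProperlyCrossAt (A B : Set (ℝ × ℝ)) (p : ℝ × ℝ) : Prop :=
  p ∈ A ∧ p ∈ B ∧ ∃ φ : OpenPartialHomeomorph (ℝ × ℝ) (ℝ × ℝ), p ∈ φ.source ∧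
    ∀ x ∈ φ.source, (x ∈ A ↔ (φ x).2 = 0) ∧ (x ∈ B ↔ (φ x).1 = 0)

/-- A good drawing in the plane of a simple graph `G`. As `G` is simple, it has no parallel edges
and no loops, so the curves of two edges share at most one point and no edge-curve intersects
itself. -/
structure GoodDrawing {V : Type*} (G : SimpleGraph V) where
  /-- the point that represents a vertex -/
  point : V → ℝ × ℝ
  /-- the curve, as a set of points, that represents an edge -/
  curve : G.edgeSet → Set (ℝ × ℝ)
  isArc : ∀ (u v : V) (h : G.Adj u v), IsArc (point u) (point v) (curve ⟨s(u, v), h⟩)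
  point_injective : Function.Injective point
  end_of_point_mem : ∀ (e : G.edgeSet) (v : V), point v ∈ curve e → v ∈ (e : Sym2 V)
  properlyCross : ∀ e f : G.edgeSet, e ≠ f → ∀ p ∈ curve e ∩ curve f,
    (¬ ∃ v, v ∈ (e : Sym2 V) ∧ v ∈ (f : Sym2 V) ∧ point v = p) →
      ProperlyCrossAt (curve e) (curve f) p
  no_triple : ∀ e f g : G.edgeSet, e ≠ f → e ≠ g → f ≠ g →
    ∀ p ∈ curve e ∩ curve f ∩ curve g,
      ∃ v, v ∈ (e : Sym2 V) ∧ v ∈ (f : Sym2 V) ∧ v ∈ (g : Sym2 V) ∧ point v = p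
  inter_subsingleton : ∀ e f : G.edgeSet, e ≠ f → (curve e ∩ curve f).Subsingleton

namespace GoodDrawing

variable {V : Type*} {G H : SimpleGraph V}

/-- The crossings in which the edge `e` participates: the points that the curve of `e` shares with
the curve of another edge and that are not a common endpoint. By `no_triple`, each of them lies on
exactly one other edge. -/
def crossings (Γ : GoodDrawing G) (e : G.edgeSet) : Set (ℝ × ℝ) :=
  {p | ∃ f : G.edgeSet, f ≠ e ∧ p ∈ Γ.curve e ∩ Γ.curve f ∧
    ¬ ∃ v, v ∈ (e : Sym2 V) ∧ v ∈ (f : Sym2 V) ∧ Γ.point v = p}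

/-- Every edge participates in at most `k` crossings. -/
def IsKPlanar (Γ : GoodDrawing G) (k : ℕ) : Prop :=
  ∀ e : G.edgeSet, (Γ.crossings e).encard ≤ k

/-- `Γ'` arises from `Γ` by adding edges: vertices and old edges are drawn as before. -/
def Extends (Γ' : GoodDrawing H) (Γ : GoodDrawing G) : Prop :=
  ∃ h : G ≤ H, Γ'.point = Γ.point ∧
    ∀ e : G.edgeSet, Γ'.curve ⟨e, SimpleGraph.edgeSet_mono h e.2⟩ = Γ.curve e

/-- A 1-planar drawing of a simple graph to which no edge between distinct non-adjacent vertices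
can be added such that the result is again a (good) 1-planar drawing. -/
def IsSimpleSaturated (Γ : GoodDrawing G) : Prop :=
  Γ.IsKPlanar 1 ∧
    ∀ u v : V, u ≠ v → ¬ G.Adj u v →
      ¬ ∃ Γ' : GoodDrawing (G ⊔ SimpleGraph.edge u v), Γ'.Extends Γ ∧ Γ'.IsKPlanar 1

end GoodDrawing

/-- The size of a maximum matching of a finite graph. -/
noncomputable def matchingNumber {V : Type*} [Finite V] (G : SimpleGraph V) : ℕ :=
  sSup {k | ∃ M : G.Subgraph, M.IsMatching ∧ M.edgeSet.ncard = k}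

theorem isGreatest_matchingNumber {V : Type*} [Finite V] (G : SimpleGraph V) :
    IsGreatest {k | ∃ M : G.Subgraph, M.IsMatching ∧ M.edgeSet.ncard = k} (matchingNumber G) := by
  have hb : BddAbove {k | ∃ M : G.Subgraph, M.IsMatching ∧ M.edgeSet.ncard = k} := by
    refine ⟨Nat.card (Sym2 V), ?_⟩
    rintro k ⟨M, -, rfl⟩
    exact Set.ncard_le_card M.edgeSet
  have hne : {k | ∃ M : G.Subgraph, M.IsMatching ∧ M.edgeSet.ncard = k}.Nonempty :=
    ⟨_, ⊥, by intro v hv; exact absurd hv (by simp), rfl⟩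
  exact ⟨Nat.sSup_mem hne hb, fun k hk => le_csSup hb hk⟩

end OnePlanar

/-!
The graph has two poles, which are adjacent to each other and to every other vertex, and `m`
columns. A column consists of a center `c`, an upper vertex `u`, a lower vertex `l` and a gap vertex
`g`, and its only edges that avoid the poles are `cu` and `cl`. So there are `n = 4 * m + 2`
vertices, and the `m + 2 = (n + 6) / 4` poles and centers form a vertex cover, whence the bound on
matchings (`matchingNumber_le_of_cover`, `matchingNumber_columnGraph_le`). Behind this is
a triangulation with `m` parallel edges between the poles, whose vertices are the poles and the
centers: each of its `3 * m` edges is accompanied by one of the pairwise non-adjacent vertices `u`,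
`l`, `g`.

The drawing lives in strip coordinates `(t, y)`, where `-1 ≤ y ≤ 1` and the lines `y = 1` and
`y = -1` are collapsed to the north pole and to the south pole. All edges are straight there:
relative to the column, `c = (0, 0)`, `u = (0, 1/2)`, `l = (0, -1/2)`, `g = (2, 0)`. The edge from
`c` to the north pole crosses the edge from `u` to the south pole to the left of `c`; the edge from
`c` to the south pole crosses the edge from `l` to the north pole to the right of `c`; all other
edges are vertical and uncrossed. The lemma `meet` says that there are no other meeting points.

For saturation, a new edge cannot cross an edge that is crossed already. Hence its curve cannot
leave an open set whose frontier consists of crossed edges and vertices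
(`GoodDrawing.not_exists_extends_of_frontier`), which requires only that an interval is connected.
Two distinct non-adjacent vertices are never poles, and they are separated by one of three such
sets: a column without its gap vertex (`not_exists_extends_column`), a triangle in a column with
only the upper vertex inside (`not_exists_extends_upper_lower`), or the part of the strip between
two columns (`not_exists_extends_gap`).
-/

namespace OnePlanar

/-! ### Blocking an additional edge -/

namespace GoodDrawing

variable {V : Type*} {G : SimpleGraph V}

/-- In a 1-planar drawing that contains `Γ`, the curve of a new edge `uv` meets an edge that is
already crossed in `Γ` at most in the points of `u` and `v`: any other common point would have to
be the old crossing, and then three edges would pass through it. -/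
theorem eq_point_of_mem_crossed {Γ : GoodDrawing G} {u v : V} (huv : u ≠ v) (hG : ¬ G.Adj u v)
    {Γ' : GoodDrawing (G ⊔ SimpleGraph.edge u v)} (hext : Γ'.Extends Γ) (hΓ' : Γ'.IsKPlanar 1)
    (hadj : (G ⊔ SimpleGraph.edge u v).Adj u v)
    {e : G.edgeSet} (he : (Γ.crossings e).Nonempty) {P : ℝ × ℝ}
    (hPe : P ∈ Γ.curve e) (hP : P ∈ Γ'.curve ⟨s(u, v), hadj⟩) :
    P = Γ.point u ∨ P = Γ.point v := by
  obtain ⟨hle, hpt, hcurve⟩ := hext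
  obtain ⟨X, f, hfe, ⟨hXe, hXf⟩, hX⟩ := he
  set n : (G ⊔ SimpleGraph.edge u v).edgeSet := ⟨s(u, v), hadj⟩
  set e' : (G ⊔ SimpleGraph.edge u v).edgeSet := ⟨e, SimpleGraph.edgeSet_mono hle e.2⟩
  set f' : (G ⊔ SimpleGraph.edge u v).edgeSet := ⟨f, SimpleGraph.edgeSet_mono hle f.2⟩
  have new_ne : ∀ g : G.edgeSet, (g : Sym2 V) ≠ s(u, v) := fun g hg =>
    hG (by rw [← SimpleGraph.mem_edgeSet, ← hg]; exact g.2)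
  have hne : n ≠ e' := fun h => new_ne e (congrArg Subtype.val h).symm
  have hnf : n ≠ f' := fun h => new_ne f (congrArg Subtype.val h).symm
  have hef : e' ≠ f' := fun h => hfe (Subtype.ext (congrArg Subtype.val h).symm)
  by_contra hcon
  push Not at hcon
  have hPn : ¬ ∃ w, w ∈ (e' : Sym2 V) ∧ w ∈ (n : Sym2 V) ∧ Γ'.point w = P := by
    rintro ⟨w, -, hw, rfl⟩
    rw [hpt] at hcon
    rcases Sym2.mem_iff.1 hw with rfl | rfl
    exacts [hcon.1 rfl, hcon.2 rfl]
  have hP' : P ∈ Γ'.crossings e' :=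
    ⟨n, hne, ⟨by rw [hcurve]; exact hPe, hP⟩, hPn⟩
  have hX' : X ∈ Γ'.crossings e' := by
    refine ⟨f', hef.symm, ⟨by rw [hcurve]; exact hXe, by rw [hcurve]; exact hXf⟩, ?_⟩
    rw [hpt]; exact hX
  have hPX : P = X := Set.encard_le_one_iff.1 (hΓ' e') P X hP' hX'
  subst hPX
  obtain ⟨w, hw⟩ := Γ'.no_triple n e' f' hne hnf hef P
    ⟨⟨hP, by rw [hcurve]; exact hPe⟩, by rw [hcurve]; exact hXf⟩
  exact hPn ⟨w, hw.2.1, hw.1, hw.2.2.2⟩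

/-- If an open set contains the point of `u`, does not have the point of `v` in its closure, and
its frontier consists of vertex-points and of points on crossed edges, then no edge `uv` can be
added: its curve would have to leave the open set. -/
theorem not_exists_extends_of_frontier {Γ : GoodDrawing G} {u v : V} (huv : u ≠ v)
    (hG : ¬ G.Adj u v) {O : Set (ℝ × ℝ)} (hO : IsOpen O) (hu : Γ.point u ∈ O)
    (hv : Γ.point v ∉ closure O)
    (hfr : ∀ P ∈ frontier O, (∃ w, Γ.point w = P) ∨
      ∃ e, (Γ.crossings e).Nonempty ∧ P ∈ Γ.curve e) :
    ¬ ∃ Γ' : GoodDrawing (G ⊔ SimpleGraph.edge u v), Γ'.Extends Γ ∧ Γ'.IsKPlanar 1 := by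
  rintro ⟨Γ', hext, hΓ'⟩
  have hadj : (G ⊔ SimpleGraph.edge u v).Adj u v := by simp [SimpleGraph.edge_adj, huv]
  have hpt : Γ'.point = Γ.point := hext.2.1
  obtain ⟨γ, -, hγ⟩ := Γ'.isArc u v hadj
  have hne : (frontier (γ ⁻¹' O)).Nonempty := by
    refine nonempty_frontier_iff.2 ⟨⟨0, by simpa [hpt] using hu⟩, fun h => hv (subset_closure ?_)⟩
    have h1 : (1 : unitInterval) ∈ γ ⁻¹' O := h ▸ Set.mem_univ _
    simpa [hpt] using h1
  obtain ⟨t, ht⟩ := hne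
  have htO : γ t ∈ frontier O := γ.continuous.frontier_preimage_subset O ht
  have hmem : γ t ∈ Γ'.curve ⟨s(u, v), hadj⟩ := hγ ▸ Set.mem_range_self t
  have hnot : ¬ (γ t = Γ.point u ∨ γ t = Γ.point v) := by
    rintro (h | h)
    · rw [hO.frontier_eq, h] at htO
      exact htO.2 hu
    · rw [h] at htO
      exact hv (frontier_subset_closure htO)
  rcases hfr _ htO with ⟨w, hw⟩ | ⟨e, he, hPe⟩
  · rw [← hw, ← hpt] at hmem
    rcases Sym2.mem_iff.1 (Γ'.end_of_point_mem _ w hmem) with rfl | rfl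
    exacts [hnot (Or.inl hw.symm), hnot (Or.inr hw.symm)]
  · exact hnot (eq_point_of_mem_crossed huv hG hext hΓ' hadj he hPe hmem)

end GoodDrawing

/-! ### Matchings and vertex covers -/

/-- A set of vertices that meets every edge has at least as many elements as any matching. -/
theorem matchingNumber_le_of_cover {V : Type*} [Finite V] {G : SimpleGraph V} (S : Set V)
    (hS : ∀ u v, G.Adj u v → u ∈ S ∨ v ∈ S) : matchingNumber G ≤ S.ncard := by
  obtain ⟨M, hM, hcard⟩ := (isGreatest_matchingNumber G).1
  rw [← hcard]
  have hex : ∀ e : Sym2 V, e ∈ M.edgeSet → ∃ w, w ∈ e ∧ w ∈ S := by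
    intro e
    induction e with
    | _ u v =>
      intro he
      rcases hS u v (M.adj_sub he) with h | h
      exacts [⟨u, Sym2.mem_mk_left u v, h⟩, ⟨v, Sym2.mem_mk_right u v, h⟩]
  rcases isEmpty_or_nonempty V with hV | hV
  · rw [Set.eq_empty_of_forall_notMem fun e he => hV.elim (hex e he).choose, Set.ncard_empty]
    exact Nat.zero_le _
  choose! f hf hfS using hex
  refine Set.ncard_le_ncard_of_injOn f hfS ?_ (Set.toFinite S)
  intro e he e' he' hee
  obtain ⟨a, ha⟩ := Sym2.mem_iff_exists.1 (hf e he)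
  obtain ⟨b, hb⟩ := Sym2.mem_iff_exists.1 (hf e' he')
  rw [ha, SimpleGraph.Subgraph.mem_edgeSet] at he
  rw [hb, SimpleGraph.Subgraph.mem_edgeSet, ← hee] at he'
  rw [ha, hb, ← hee, hM.eq_of_adj_left he he']

/-! ### Curves and regions in strip coordinates -/

/-- The map from strip coordinates `(t, y)`, `-1 ≤ y ≤ 1`, to the plane. It is a homeomorphism of
the open strip and collapses the line `y = 1` to the pole `(0, 1)` and the line `y = -1` to the
pole `(0, -1)`. -/
def strip (t y : ℝ) : ℝ × ℝ := (t * (1 - y ^ 2), y)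

theorem strip_inj {t y t' y' : ℝ} (hy : y ^ 2 < 1) :
    strip t y = strip t' y' ↔ t = t' ∧ y = y' := by
  constructor
  · intro h
    obtain ⟨h1, h2⟩ := Prod.mk.inj h
    subst h2
    exact ⟨mul_right_cancel₀ (by linarith) h1, rfl⟩
  · rintro ⟨rfl, rfl⟩; rfl

/-- The image in the plane of the graph of `t = α + β y` over `lo ≤ y ≤ hi`. -/
def stripSegment (α β lo hi : ℝ) : Set (ℝ × ℝ) :=
  (fun y => strip (α + β * y) y) '' Set.Icc lo hi

theorem strip_mem_stripSegment {α β lo hi t y : ℝ} (hy : y ^ 2 < 1) :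
    strip t y ∈ stripSegment α β lo hi ↔ t = α + β * y ∧ lo ≤ y ∧ y ≤ hi := by
  constructor
  · rintro ⟨z, hz, h⟩
    obtain ⟨h1, rfl⟩ := (strip_inj hy).1 h.symm
    exact ⟨h1, hz⟩
  · rintro ⟨rfl, h⟩
    exact ⟨y, h, rfl⟩

theorem isArc_stripSegment {α β lo hi : ℝ} (h : lo < hi) {a b : ℝ × ℝ}
    (ha : strip (α + β * lo) lo = a) (hb : strip (α + β * hi) hi = b) :
    IsArc a b (stripSegment α β lo hi) := by
  subst ha hb
  have hcont : Continuous fun y : ℝ => strip (α + β * y) y := by unfold strip; fun_prop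
  have key : (fun s : unitInterval => lo + s * (hi - lo)) '' Set.univ = Set.Icc lo hi := by
    ext y
    constructor
    · rintro ⟨s, -, rfl⟩
      have h0 := s.2.1
      have h1 := s.2.2
      constructor <;> dsimp only <;> nlinarith
    · rintro ⟨h1, h2⟩
      have hpos : 0 < hi - lo := sub_pos.2 h
      refine ⟨⟨(y - lo) / (hi - lo), by apply div_nonneg <;> linarith,
        by rw [div_le_one hpos]; linarith⟩, trivial, ?_⟩
      dsimp only
      field_simp
      ring
  refine ⟨⟨⟨fun s => strip (α + β * (lo + s * (hi - lo))) (lo + s * (hi - lo)),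
    hcont.comp (by fun_prop)⟩, by simp, by simp⟩, ?_, ?_⟩
  · intro s s' hs
    have h2 := (Prod.mk.inj hs).2
    exact Subtype.ext (mul_right_cancel₀ (sub_ne_zero.2 h.ne') (add_left_cancel h2))
  · rw [stripSegment, ← key, Set.image_image, Set.image_univ]
    rfl

theorem IsArc.symm {a b : ℝ × ℝ} {A : Set (ℝ × ℝ)} (h : IsArc a b A) : IsArc b a A := by
  obtain ⟨γ, hγ, rfl⟩ := h
  refine ⟨γ.symm, ?_, γ.symm_range⟩
  exact hγ.comp unitInterval.symm_involutive.injective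

/-- Two segments of different slopes in strip coordinates cross properly at a common interior
point; the chart takes them to the axes by an affine map of the strip coordinates. -/
theorem properlyCrossAt_stripSegment {α β lo hi α' β' lo' hi' t y : ℝ} (hβ : β ≠ β')
    (hlo : -1 ≤ lo) (hhi : hi ≤ 1) (h1 : lo < y) (h2 : y < hi) (h1' : lo' < y) (h2' : y < hi')
    (ht : t = α + β * y) (ht' : t = α' + β' * y) :
    ProperlyCrossAt (stripSegment α β lo hi) (stripSegment α' β' lo' hi') (strip t y) := by
  have hsq : ∀ z : ℝ, lo < z → z < hi → z ^ 2 < 1 := fun z _ _ => by nlinarith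
  have hy := hsq y h1 h2
  refine ⟨(strip_mem_stripSegment hy).2 ⟨ht, h1.le, h2.le⟩,
    (strip_mem_stripSegment hy).2 ⟨ht', h1'.le, h2'.le⟩, ?_⟩
  have hd : β' - β ≠ 0 := sub_ne_zero.2 hβ.symm
  -- the height of the point of the strip with given distances from the two lines
  let height : ℝ × ℝ → ℝ := fun q => (q.2 - q.1 + α - α') / (β' - β)
  have hheight : Continuous height := by fun_prop
  let I : Set ℝ := Set.Ioo lo hi ∩ Set.Ioo lo' hi'
  have hI : IsOpen I := isOpen_Ioo.inter isOpen_Ioo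
  have hpos : ∀ z ∈ I, 1 - z ^ 2 ≠ 0 := fun z hz => by
    have := hsq z hz.1.1 hz.1.2
    linarith
  refine ⟨{
    toFun := fun P => (P.1 / (1 - P.2 ^ 2) - (α' + β' * P.2), P.1 / (1 - P.2 ^ 2) - (α + β * P.2))
    invFun := fun q => strip (α + β * height q + q.2) (height q)
    source := {P | P.2 ∈ I}
    target := {q | height q ∈ I}
    map_source' := ?_
    map_target' := fun q hq => hq
    left_inv' := ?_
    right_inv' := ?_
    open_source := hI.preimage continuous_snd
    open_target := hI.preimage hheight
    continuousOn_toFun := ?_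
    continuousOn_invFun := ?_ }, ⟨⟨h1, h2⟩, h1', h2'⟩, ?_⟩
  · intro P hP
    have : height (P.1 / (1 - P.2 ^ 2) - (α' + β' * P.2),
        P.1 / (1 - P.2 ^ 2) - (α + β * P.2)) = P.2 := by
      simp only [height]; field_simp; ring
    simpa only [Set.mem_ofPred_eq, this] using hP
  · intro P hP
    have : height (P.1 / (1 - P.2 ^ 2) - (α' + β' * P.2),
        P.1 / (1 - P.2 ^ 2) - (α + β * P.2)) = P.2 := by
      simp only [height]; field_simp; ring
    have h0 := hpos P.2 hP
    simp only [this]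
    refine Prod.ext ?_ rfl
    simp only [strip]
    field_simp
    ring
  · intro q hq
    have h0 := hpos _ hq
    have h3 : height q * (β' - β) = q.2 - q.1 + α - α' := div_mul_cancel₀ _ hd
    simp only [strip, mul_div_cancel_right₀ _ h0]
    refine Prod.ext ?_ ?_
    · dsimp only; linarith
    · dsimp only; ring
  · have hc : ContinuousOn (fun P : ℝ × ℝ => P.1 / (1 - P.2 ^ 2)) {P | P.2 ∈ I} :=
      ContinuousOn.div (by fun_prop) (by fun_prop) fun P hP => hpos P.2 hP
    exact (hc.sub (by fun_prop)).prodMk (hc.sub (by fun_prop))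
  · refine Continuous.continuousOn ?_
    unfold strip
    fun_prop
  · rintro ⟨x, z⟩ hz
    have h0 : 1 - z ^ 2 ≠ 0 := hpos z hz
    have hz2 := hsq z hz.1.1 hz.1.2
    obtain ⟨s, rfl⟩ : ∃ s, x = s * (1 - z ^ 2) := ⟨x / (1 - z ^ 2), (div_mul_cancel₀ _ h0).symm⟩
    have hs : s * (1 - z ^ 2) / (1 - z ^ 2) = s := mul_div_cancel_right₀ _ h0
    constructor
    · refine (strip_mem_stripSegment hz2).trans ?_
      change _ ↔ s * (1 - z ^ 2) / (1 - z ^ 2) - (α + β * z) = 0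
      rw [hs, sub_eq_zero]
      exact and_iff_left ⟨hz.1.1.le, hz.1.2.le⟩
    · refine (strip_mem_stripSegment hz2).trans ?_
      change _ ↔ s * (1 - z ^ 2) / (1 - z ^ 2) - (α' + β' * z) = 0
      rw [hs, sub_eq_zero]
      exact and_iff_left ⟨hz.2.1.le, hz.2.2.le⟩

/-- The image in the plane of the part of the open strip strictly between the graphs of
`t = a y` and `t = b y`. -/
def stripRegion (a b : ℝ → ℝ) : Set (ℝ × ℝ) :=
  {P | P.2 ^ 2 < 1 ∧ a P.2 * (1 - P.2 ^ 2) < P.1 ∧ P.1 < b P.2 * (1 - P.2 ^ 2)}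

section Region

variable {a b : ℝ → ℝ}

theorem isOpen_stripRegion (ha : Continuous a) (hb : Continuous b) : IsOpen (stripRegion a b) :=
  (isOpen_lt (by fun_prop) (by fun_prop)).and
    ((isOpen_lt (by fun_prop) (by fun_prop)).and (isOpen_lt (by fun_prop) (by fun_prop)))

theorem strip_mem_stripRegion {t y : ℝ} (hy : y ^ 2 < 1) (h1 : a y < t) (h2 : t < b y) :
    strip t y ∈ stripRegion a b :=
  ⟨hy, mul_lt_mul_of_pos_right h1 (sub_pos.2 hy), mul_lt_mul_of_pos_right h2 (sub_pos.2 hy)⟩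

theorem closure_stripRegion_subset (ha : Continuous a) (hb : Continuous b) :
    closure (stripRegion a b) ⊆
      {P | P.2 ^ 2 ≤ 1 ∧ a P.2 * (1 - P.2 ^ 2) ≤ P.1 ∧ P.1 ≤ b P.2 * (1 - P.2 ^ 2)} :=
  closure_minimal (fun _ hP => ⟨hP.1.le, hP.2.1.le, hP.2.2.le⟩)
    ((isClosed_le (by fun_prop) (by fun_prop)).and
      ((isClosed_le (by fun_prop) (by fun_prop)).and (isClosed_le (by fun_prop) (by fun_prop))))

theorem strip_notMem_closure_stripRegion (ha : Continuous a) (hb : Continuous b) {t y : ℝ}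
    (hy : y ^ 2 < 1) (h : t < a y ∨ b y < t) : strip t y ∉ closure (stripRegion a b) := by
  intro hmem
  obtain ⟨-, h1, h2⟩ := closure_stripRegion_subset ha hb hmem
  have h1' : a y ≤ t := le_of_mul_le_mul_right h1 (sub_pos.2 hy)
  have h2' : t ≤ b y := le_of_mul_le_mul_right h2 (sub_pos.2 hy)
  rcases h with h | h <;> linarith

/-- The frontier of a strip region consists of points on the two bounding graphs and of poles. -/
theorem frontier_stripRegion (ha : Continuous a) (hb : Continuous b) {P : ℝ × ℝ}
    (hP : P ∈ frontier (stripRegion a b)) :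
    P = (0, 1) ∨ P = (0, -1) ∨ ∃ t y, P = strip t y ∧ y ^ 2 < 1 ∧ a y ≤ t ∧ t ≤ b y ∧
      (t = a y ∨ t = b y) := by
  rw [(isOpen_stripRegion ha hb).frontier_eq] at hP
  obtain ⟨hcl, hnot⟩ := hP
  obtain ⟨x, y⟩ := P
  obtain ⟨h0, h1, h2⟩ := closure_stripRegion_subset ha hb hcl
  dsimp only at h0 h1 h2
  rcases h0.lt_or_eq with hy | hy
  · right; right
    have hpos : 0 < 1 - y ^ 2 := sub_pos.2 hy
    obtain ⟨t, rfl⟩ : ∃ t, x = t * (1 - y ^ 2) := ⟨x / (1 - y ^ 2), by field_simp⟩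
    have h1' : a y ≤ t := le_of_mul_le_mul_right h1 hpos
    have h2' : t ≤ b y := le_of_mul_le_mul_right h2 hpos
    refine ⟨t, y, rfl, hy, h1', h2', ?_⟩
    by_contra! hcon
    exact hnot (strip_mem_stripRegion hy (lt_of_le_of_ne h1' hcon.1.symm)
      (lt_of_le_of_ne h2' hcon.2))
  · have hx : x = 0 := by rw [hy] at h1 h2; linarith
    subst hx
    rcases sq_eq_one_iff.1 hy with h | h
    all_goals simp [h]

end Region

/-! ### The graph -/

/-- The four vertices of one column: one in its center, one above and one below the center, and
one in the gap between this column and the next. -/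
inductive Spot
  | center
  | upper
  | lower
  | gap

instance : Fintype Spot where
  elems := ⟨([.center, .upper, .lower, .gap] : List Spot), by simp⟩
  complete s := by cases s <;> simp

/-- The vertices of the graph with `m` columns: the two poles `Sum.inl true` (north) and
`Sum.inl false` (south), and four vertices in each column. -/
abbrev Vertex (m : ℕ) : Type := Bool ⊕ (Fin m × Spot)

/-- The ten edges that belong to one column, each named by its two ends. -/
inductive Link
  | centerNorth
  | upperSouth
  | centerSouth
  | lowerNorth
  | upperNorth
  | centerUpper
  | lowerCenter
  | lowerSouth
  | gapNorth
  | gapSouth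

/-- The edges of the graph with `m` columns; `none` is the edge between the poles. -/
abbrev Edge (m : ℕ) : Type := Option (Fin m × Link)

variable {m : ℕ}

/-- The lower end of an edge. -/
def bot : Edge m → Vertex m
  | none => .inl false
  | some (i, .centerNorth) => .inr (i, .center)
  | some (_, .upperSouth) => .inl false
  | some (_, .centerSouth) => .inl false
  | some (i, .lowerNorth) => .inr (i, .lower)
  | some (i, .upperNorth) => .inr (i, .upper)
  | some (i, .centerUpper) => .inr (i, .center)
  | some (i, .lowerCenter) => .inr (i, .lower)
  | some (_, .lowerSouth) => .inl false
  | some (i, .gapNorth) => .inr (i, .gap)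
  | some (_, .gapSouth) => .inl false

/-- The upper end of an edge. -/
def top : Edge m → Vertex m
  | none => .inl true
  | some (_, .centerNorth) => .inl true
  | some (i, .upperSouth) => .inr (i, .upper)
  | some (i, .centerSouth) => .inr (i, .center)
  | some (_, .lowerNorth) => .inl true
  | some (_, .upperNorth) => .inl true
  | some (i, .centerUpper) => .inr (i, .upper)
  | some (i, .lowerCenter) => .inr (i, .center)
  | some (i, .lowerSouth) => .inr (i, .lower)
  | some (_, .gapNorth) => .inl true
  | some (i, .gapSouth) => .inr (i, .gap)

/-- The unordered pair of ends of an edge. -/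
def ends (e : Edge m) : Sym2 (Vertex m) := s(bot e, top e)

/-- The `y`-coordinate of a vertex, the same in the plane and in strip coordinates. -/
noncomputable def level : Vertex m → ℝ
  | .inl true => 1
  | .inl false => -1
  | .inr (_, .center) => 0
  | .inr (_, .upper) => 1 / 2
  | .inr (_, .lower) => -1 / 2
  | .inr (_, .gap) => 0

/-- The `t`-coordinate of a vertex relative to its column. -/
noncomputable def Spot.shift : Spot → ℝ
  | .gap => 2
  | _ => 0

/-- The `t`-coordinate of a vertex. Columns are four units apart. At the poles `strip` does not
depend on `t`, and the value is arbitrary. -/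
noncomputable def abscissa : Vertex m → ℝ
  | .inl _ => 0
  | .inr (i, s) => 4 * (i : ℕ) + s.shift

/-- The slope of an edge, which is a segment in strip coordinates. -/
noncomputable def Link.slope : Link → ℝ
  | .centerNorth => -1
  | .centerSouth => -1
  | .upperSouth => 1
  | .lowerNorth => 1
  | _ => 0

/-- The `t`-coordinate, relative to the column, at which the line of an edge meets `y = 0`. -/
noncomputable def Link.shift : Link → ℝ
  | .upperSouth => -1 / 2
  | .lowerNorth => 1 / 2
  | .gapNorth => 2
  | .gapSouth => 2
  | _ => 0

/-- The slope of an edge in strip coordinates. -/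
noncomputable def slope : Edge m → ℝ
  | none => 0
  | some (_, a) => a.slope

/-- The `t`-coordinate at which the line of an edge meets `y = 0`. The edge between the poles runs
to the left of all columns. -/
noncomputable def offset : Edge m → ℝ
  | none => -2
  | some (i, a) => 4 * (i : ℕ) + a.shift

/-- The edge of the same column that crosses a given one, if there is any. -/
def Link.mate : Link → Option Link
  | .centerNorth => some .upperSouth
  | .upperSouth => some .centerNorth
  | .centerSouth => some .lowerNorth
  | .lowerNorth => some .centerSouth
  | _ => none

/-- The `y`-coordinate of the crossing of an edge; meaningful only for edges with a mate. -/
noncomputable def Link.crossLevel : Link → ℝ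
  | .centerNorth => 1 / 4
  | .upperSouth => 1 / 4
  | _ => -1 / 4

theorem level_le_one (w : Vertex m) : level w ≤ 1 := by
  rcases w with (_ | _) | ⟨i, _ | _ | _ | _⟩ <;> norm_num [level]

theorem neg_one_le_level (w : Vertex m) : -1 ≤ level w := by
  rcases w with (_ | _) | ⟨i, _ | _ | _ | _⟩ <;> norm_num [level]

theorem eq_north_of_one_le_level {w : Vertex m} (h : 1 ≤ level w) : w = .inl true := by
  rcases w with (_ | _) | ⟨i, _ | _ | _ | _⟩ <;> first | rfl | (norm_num [level] at h)

theorem eq_south_of_level_le {w : Vertex m} (h : level w ≤ -1) : w = .inl false := by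
  rcases w with (_ | _) | ⟨i, _ | _ | _ | _⟩ <;> first | rfl | (norm_num [level] at h)

theorem level_inr_sq_lt_one (x : Fin m × Spot) : level (.inr x : Vertex m) ^ 2 < 1 := by
  rcases x with ⟨i, _ | _ | _ | _⟩ <;> norm_num [level]

theorem level_bot_lt_level_top (e : Edge m) : level (bot e) < level (top e) := by
  rcases e with _ | ⟨i, a⟩
  · norm_num [bot, top, level]
  · cases a <;> norm_num [bot, top, level]

theorem bot_ne_top (e : Edge m) : bot e ≠ top e := fun h =>
  (level_bot_lt_level_top e).ne (congrArg level h)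

theorem ends_injective : Function.Injective (ends : Edge m → Sym2 (Vertex m)) := by
  intro e f h
  rcases Sym2.eq_iff.1 h with ⟨h1, h2⟩ | ⟨h1, h2⟩
  · rcases e with _ | ⟨i, a⟩ <;> rcases f with _ | ⟨j, b⟩
    · rfl
    · cases b <;> simp [bot, top] at h1 h2
    · cases a <;> simp [bot, top] at h1 h2
    · cases a <;> cases b <;> simp_all [bot, top]
  · have he := level_bot_lt_level_top e
    have hf := level_bot_lt_level_top f
    rw [h1, h2] at he
    exact absurd hf he.asymm

/-- The graph with `m` columns. -/
def columnGraph (m : ℕ) : SimpleGraph (Vertex m) :=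
  SimpleGraph.fromEdgeSet (Set.range ends)

theorem ends_mem_edgeSet (e : Edge m) : ends e ∈ (columnGraph m).edgeSet := by
  rw [columnGraph, SimpleGraph.edgeSet_fromEdgeSet]
  exact ⟨⟨e, rfl⟩, fun h => bot_ne_top e h⟩

theorem exists_ends_eq (e : (columnGraph m).edgeSet) : ∃ f : Edge m, ends f = e := by
  have h : (e : Sym2 (Vertex m)) ∈ (SimpleGraph.fromEdgeSet (Set.range ends)).edgeSet := e.2
  rw [SimpleGraph.edgeSet_fromEdgeSet] at h
  exact h.1

/-- The name of an edge of `columnGraph m`. -/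
noncomputable def index (e : (columnGraph m).edgeSet) : Edge m := (exists_ends_eq e).choose

theorem ends_index (e : (columnGraph m).edgeSet) : ends (index e) = e :=
  (exists_ends_eq e).choose_spec

theorem index_injective : Function.Injective (index : (columnGraph m).edgeSet → Edge m) :=
  fun e f h => Subtype.ext (by rw [← ends_index, h, ends_index])

theorem index_ends (e : Edge m) : index ⟨ends e, ends_mem_edgeSet e⟩ = e :=
  ends_injective (ends_index _)

theorem adj_of_ends (e : Edge m) : (columnGraph m).Adj (bot e) (top e) := ends_mem_edgeSet e

/-! ### The drawing -/

/-- The point of a vertex. -/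
noncomputable def vertexPoint (w : Vertex m) : ℝ × ℝ := strip (abscissa w) (level w)

/-- The curve of an edge: in strip coordinates, the part of its line between the levels of its
ends. -/
noncomputable def edgeCurve (e : Edge m) : Set (ℝ × ℝ) :=
  stripSegment (offset e) (slope e) (level (bot e)) (level (top e))

theorem strip_level_bot (e : Edge m) :
    strip (offset e + slope e * level (bot e)) (level (bot e)) = vertexPoint (bot e) := by
  rcases e with _ | ⟨i, a⟩
  · simp [vertexPoint, strip, bot, level]
  · cases a
    all_goals simp [vertexPoint, strip, bot, level, offset, slope, abscissa, Link.slope,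
      Link.shift, Spot.shift]
    all_goals norm_num

theorem strip_level_top (e : Edge m) :
    strip (offset e + slope e * level (top e)) (level (top e)) = vertexPoint (top e) := by
  rcases e with _ | ⟨i, a⟩
  · simp [vertexPoint, strip, top, level]
  · cases a
    all_goals simp [vertexPoint, strip, top, level, offset, slope, abscissa, Link.slope,
      Link.shift, Spot.shift]
    all_goals norm_num

theorem isArc_edgeCurve (e : Edge m) : IsArc (vertexPoint (bot e)) (vertexPoint (top e))
    (edgeCurve e) :=
  isArc_stripSegment (level_bot_lt_level_top e) (strip_level_bot e) (strip_level_top e)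

/-- Distinct columns are further apart than the parts of a column are from its axis. -/
theorem column_eq {i j : Fin m} {s t : ℝ} (h : 4 * ((i : ℕ) : ℝ) + s = 4 * ((j : ℕ) : ℝ) + t)
    (hs : -3 / 2 ≤ s) (hs' : s ≤ 2) (ht : -3 / 2 ≤ t) (ht' : t ≤ 2) : i = j := by
  have h1 : ((i : ℕ) : ℝ) < ((j : ℕ) : ℝ) + 1 := by linarith
  have h2 : ((j : ℕ) : ℝ) < ((i : ℕ) : ℝ) + 1 := by linarith
  have h1' : (i : ℕ) < j + 1 := by exact_mod_cast h1
  have h2' : (j : ℕ) < i + 1 := by exact_mod_cast h2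
  exact Fin.ext (by omega)

theorem link_bounds {i : Fin m} {a : Link} {y : ℝ} (h1 : level (bot (some (i, a))) ≤ y)
    (h2 : y ≤ level (top (some (i, a)))) :
    -3 / 2 ≤ a.shift + a.slope * y ∧ a.shift + a.slope * y ≤ 2 := by
  cases a <;> simp only [bot, top, level, Link.shift, Link.slope] at h1 h2 ⊢ <;>
    constructor <;> linarith

theorem spot_bounds (s : Spot) : -3 / 2 ≤ s.shift ∧ s.shift ≤ 2 := by
  cases s <;> norm_num [Spot.shift]

theorem vertexPoint_injective : Function.Injective (vertexPoint : Vertex m → ℝ × ℝ) := by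
  intro u w h
  have hl : level u = level w := (Prod.mk.inj h).2
  rcases u with (_ | _) | ⟨i, s⟩
  · exact (eq_south_of_level_le (w := w) (by rw [← hl]; rfl)).symm
  · exact (eq_north_of_one_le_level (w := w) (by rw [← hl]; rfl)).symm
  · rcases w with (_ | _) | ⟨j, r⟩
    · exact eq_south_of_level_le hl.le
    · exact eq_north_of_one_le_level hl.ge
    · have ht := ((strip_inj (level_inr_sq_lt_one (i, s))).1 h).1
      simp only [abscissa] at ht
      obtain rfl := column_eq ht (spot_bounds s).1 (spot_bounds s).2 (spot_bounds r).1
        (spot_bounds r).2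
      have hst : s = r := by
        cases s <;> cases r <;> first
          | rfl
          | (simp only [level, Spot.shift] at hl ht; exfalso; linarith)
      rw [hst]

theorem mem_ends_of_vertexPoint_mem {e : Edge m} {w : Vertex m} (h : vertexPoint w ∈ edgeCurve e) :
    w ∈ ends e := by
  rcases w with (_ | _) | ⟨j, s⟩
  · obtain ⟨y, hy, hP⟩ := h
    obtain rfl : y = -1 := (Prod.mk.inj hP).2
    rw [← eq_south_of_level_le hy.1]
    exact Sym2.mem_mk_left _ _
  · obtain ⟨y, hy, hP⟩ := h
    obtain rfl : y = 1 := (Prod.mk.inj hP).2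
    rw [← eq_north_of_one_le_level hy.2]
    exact Sym2.mem_mk_right _ _
  · obtain ⟨ht, h1, h2⟩ := (strip_mem_stripSegment (level_inr_sq_lt_one (j, s))).1 h
    rcases e with _ | ⟨i, a⟩
    · simp only [abscissa, offset, slope] at ht
      have := (spot_bounds s).1
      have : (0 : ℝ) ≤ (j : ℕ) := Nat.cast_nonneg _
      linarith
    · have hb := link_bounds h1 h2
      simp only [abscissa, offset, slope, add_assoc] at ht
      obtain rfl := column_eq ht (spot_bounds s).1 (spot_bounds s).2 hb.1 hb.2
      cases a <;> cases s <;> simp only [bot, top, level, Link.shift, Link.slope, Spot.shift]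
        at ht h1 h2 <;> first
        | exact Sym2.mem_mk_left _ _
        | exact Sym2.mem_mk_right _ _
        | (exfalso; linarith)

/-- Two edges of one column meet in a common end or at their crossing. -/
theorem link_meet {i : Fin m} {a b : Link} (hab : a ≠ b) {y : ℝ}
    (ha1 : level (bot (some (i, a))) ≤ y) (ha2 : y ≤ level (top (some (i, a))))
    (hb1 : level (bot (some (i, b))) ≤ y) (hb2 : y ≤ level (top (some (i, b))))
    (h : a.shift + a.slope * y = b.shift + b.slope * y) :
    (∃ w, w ∈ ends (some (i, a)) ∧ w ∈ ends (some (i, b)) ∧ level w = y) ∨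
      (a.mate = some b ∧ y = a.crossLevel) := by
  cases a <;> cases b <;> first
    | exact absurd rfl hab
    | (simp only [bot, top, level, Link.shift, Link.slope] at ha1 ha2 hb1 hb2 h
       first
        | (exfalso; linarith)
        | (right; refine ⟨rfl, ?_⟩; simp only [Link.crossLevel]; linarith)
        | (left
           first
            | (refine ⟨.inr (i, .center),
                by first | exact Sym2.mem_mk_left _ _ | exact Sym2.mem_mk_right _ _,
                by first | exact Sym2.mem_mk_left _ _ | exact Sym2.mem_mk_right _ _, ?_⟩
               simp only [level]; linarith)
            | (refine ⟨.inr (i, .upper),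
                by first | exact Sym2.mem_mk_left _ _ | exact Sym2.mem_mk_right _ _,
                by first | exact Sym2.mem_mk_left _ _ | exact Sym2.mem_mk_right _ _, ?_⟩
               simp only [level]; linarith)
            | (refine ⟨.inr (i, .lower),
                by first | exact Sym2.mem_mk_left _ _ | exact Sym2.mem_mk_right _ _,
                by first | exact Sym2.mem_mk_left _ _ | exact Sym2.mem_mk_right _ _, ?_⟩
               simp only [level]; linarith)
            | (refine ⟨.inr (i, .gap),
                by first | exact Sym2.mem_mk_left _ _ | exact Sym2.mem_mk_right _ _,
                by first | exact Sym2.mem_mk_left _ _ | exact Sym2.mem_mk_right _ _, ?_⟩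
               simp only [level]; linarith)))

/-- `f` is the edge that crosses `e`. -/
def Mates (e f : Edge m) : Prop :=
  ∃ i a b, e = some (i, a) ∧ f = some (i, b) ∧ a.mate = some b

/-- The point in which an edge is crossed; meaningful only for edges with a mate. -/
noncomputable def crossPoint : Edge m → ℝ × ℝ
  | none => 0
  | some (i, a) => strip (offset (some (i, a)) + a.slope * a.crossLevel) a.crossLevel

theorem Mates.unique {e f g : Edge m} (h : Mates e f) (h' : Mates e g) : f = g := by
  obtain ⟨i, a, b, rfl, rfl, hab⟩ := h
  obtain ⟨j, a', b', he, rfl, hab'⟩ := h'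
  cases he
  rw [hab] at hab'
  cases hab'
  rfl

theorem Mates.disjoint {e f : Edge m} (h : Mates e f) {w : Vertex m} (he : w ∈ ends e)
    (hf : w ∈ ends f) : False := by
  obtain ⟨i, a, b, rfl, rfl, hab⟩ := h
  cases a <;> cases hab <;> rcases Sym2.mem_iff.1 he with rfl | rfl <;>
    simp [ends, bot, top] at hf

theorem Mates.crossPoint_mem {e f : Edge m} (h : Mates e f) :
    crossPoint e ∈ edgeCurve e ∩ edgeCurve f := by
  obtain ⟨i, a, b, rfl, rfl, hab⟩ := h
  have hsq : a.crossLevel ^ 2 < 1 := by cases a <;> norm_num [Link.crossLevel]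
  refine ⟨(strip_mem_stripSegment hsq).2 ⟨rfl, ?_⟩, (strip_mem_stripSegment hsq).2 ?_⟩
  · cases a <;> cases hab <;> norm_num [bot, top, level, Link.crossLevel]
  · cases a <;> cases hab <;> norm_num [bot, top, level, Link.crossLevel, offset, slope,
      Link.slope, Link.shift, add_assoc]

theorem Mates.properlyCrossAt {e f : Edge m} (h : Mates e f) :
    ProperlyCrossAt (edgeCurve e) (edgeCurve f) (crossPoint e) := by
  have hmem := h.crossPoint_mem
  obtain ⟨i, a, b, rfl, rfl, hab⟩ := h
  have hsq : a.crossLevel ^ 2 < 1 := by cases a <;> norm_num [Link.crossLevel]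
  have h1 := (strip_mem_stripSegment hsq).1 hmem.1
  have h2 := (strip_mem_stripSegment hsq).1 hmem.2
  refine properlyCrossAt_stripSegment ?_ (neg_one_le_level _) (level_le_one _) ?_ ?_ ?_ ?_ h1.1 h2.1
  all_goals
    cases a <;> cases hab <;> norm_num [bot, top, level, Link.crossLevel, slope, Link.slope]

/-- Two edges meet only in the point of a common end, or where they cross. -/
theorem meet {e f : Edge m} (hef : e ≠ f) {P : ℝ × ℝ} (he : P ∈ edgeCurve e)
    (hf : P ∈ edgeCurve f) :
    (∃ w, w ∈ ends e ∧ w ∈ ends f ∧ vertexPoint w = P) ∨ (Mates e f ∧ P = crossPoint e) := by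
  obtain ⟨y, ⟨h1, h2⟩, rfl⟩ := he
  dsimp only at hf ⊢
  -- only edges that end in a pole reach the levels `y = -1` and `y = 1`
  have hlo : -1 ≤ y := (neg_one_le_level _).trans h1
  have hhi : y ≤ 1 := h2.trans (level_le_one _)
  rcases hlo.eq_or_lt with rfl | hlo
  · obtain ⟨z, ⟨h1', -⟩, hz⟩ := hf
    obtain rfl : z = -1 := (Prod.mk.inj hz).2
    refine .inl ⟨.inl false, ?_, ?_, by simp [vertexPoint, level, strip]⟩
    · rw [← eq_south_of_level_le h1]; exact Sym2.mem_mk_left _ _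
    · rw [← eq_south_of_level_le h1']; exact Sym2.mem_mk_left _ _
  rcases hhi.eq_or_lt with rfl | hhi
  · obtain ⟨z, ⟨-, h2'⟩, hz⟩ := hf
    obtain rfl : z = 1 := (Prod.mk.inj hz).2
    refine .inl ⟨.inl true, ?_, ?_, by simp [vertexPoint, level, strip]⟩
    · rw [← eq_north_of_one_le_level h2]; exact Sym2.mem_mk_right _ _
    · rw [← eq_north_of_one_le_level h2']; exact Sym2.mem_mk_right _ _
  have hsq : y ^ 2 < 1 := by nlinarith
  obtain ⟨ht, h1', h2'⟩ := (strip_mem_stripSegment hsq).1 hf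
  rcases e with _ | ⟨i, a⟩ <;> rcases f with _ | ⟨j, b⟩
  · exact absurd rfl hef
  · have := link_bounds h1' h2'
    have : (0 : ℝ) ≤ (j : ℕ) := Nat.cast_nonneg _
    simp only [offset, slope] at ht
    linarith
  · have := link_bounds h1 h2
    have : (0 : ℝ) ≤ (i : ℕ) := Nat.cast_nonneg _
    simp only [offset, slope] at ht
    linarith
  · have hb := link_bounds h1 h2
    have hb' := link_bounds h1' h2'
    simp only [offset, slope, add_assoc] at ht
    obtain rfl := column_eq ht hb.1 hb.2 hb'.1 hb'.2
    have hab : a ≠ b := by rintro rfl; exact hef rfl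
    rcases link_meet hab h1 h2 h1' h2' (add_left_cancel ht) with ⟨w, hw, hw', rfl⟩ | ⟨hm, rfl⟩
    · refine .inl ⟨w, hw, hw', ?_⟩
      rcases Sym2.mem_iff.1 hw with rfl | rfl
      exacts [(strip_level_bot _).symm, (strip_level_top _).symm]
    · exact .inr ⟨⟨i, a, b, rfl, rfl, hm⟩, rfl⟩

theorem eq_of_mem_ends {e f : Edge m} (hef : e ≠ f) {u w : Vertex m} (hu : u ∈ ends e)
    (hu' : u ∈ ends f) (hw : w ∈ ends e) (hw' : w ∈ ends f) : u = w := by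
  by_contra huw
  exact hef (ends_injective (((Sym2.mem_and_mem_iff huw).1 ⟨hu, hw⟩).trans
    ((Sym2.mem_and_mem_iff huw).1 ⟨hu', hw'⟩).symm))

/-- The drawing of the graph with `m` columns. -/
noncomputable def columnDrawing (m : ℕ) : GoodDrawing (columnGraph m) where
  point := vertexPoint
  curve e := edgeCurve (index e)
  isArc u v h := by
    have hi : ends (index ⟨s(u, v), h⟩) = s(u, v) := ends_index _
    have harc := isArc_edgeCurve (index ⟨s(u, v), h⟩)
    rcases Sym2.eq_iff.1 hi with ⟨h1, h2⟩ | ⟨h1, h2⟩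
    · rwa [h1, h2] at harc
    · rw [h1, h2] at harc
      exact harc.symm
  point_injective := vertexPoint_injective
  end_of_point_mem e v h := by
    rw [← ends_index]
    exact mem_ends_of_vertexPoint_mem h
  properlyCross e f hef P hP hno := by
    rw [← ends_index e, ← ends_index f] at hno
    obtain ⟨hm, rfl⟩ := (meet (index_injective.ne hef) hP.1 hP.2).resolve_left hno
    exact hm.properlyCrossAt
  no_triple e f g hef heg hfg P hP := by
    rw [← ends_index e, ← ends_index f, ← ends_index g]
    obtain ⟨⟨he, hf⟩, hg⟩ := hP
    rcases meet (index_injective.ne hef) he hf with ⟨w, hwe, hwf, rfl⟩ | ⟨hm, -⟩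
    · exact ⟨w, hwe, hwf, mem_ends_of_vertexPoint_mem hg, rfl⟩
    rcases meet (index_injective.ne heg) he hg with ⟨w, hwe, hwg, rfl⟩ | ⟨hm', -⟩
    · exact ⟨w, hwe, mem_ends_of_vertexPoint_mem hf, hwg, rfl⟩
    · exact absurd (hm.unique hm') (index_injective.ne hfg)
  inter_subsingleton e f hef := by
    have hne := index_injective.ne hef
    rintro P ⟨hPe, hPf⟩ Q ⟨hQe, hQf⟩
    rcases meet hne hPe hPf with ⟨w, hwe, hwf, rfl⟩ | ⟨hm, rfl⟩ <;>
    rcases meet hne hQe hQf with ⟨w', hwe', hwf', rfl⟩ | ⟨hm', rfl⟩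
    · rw [eq_of_mem_ends hne hwe hwf hwe' hwf']
    · exact (hm'.disjoint hwe hwf).elim
    · exact (hm.disjoint hwe' hwf').elim
    · rfl

theorem columnDrawing_isKPlanar (m : ℕ) : (columnDrawing m).IsKPlanar 1 := by
  intro e
  have hsub : ∀ P ∈ (columnDrawing m).crossings e, P = crossPoint (index e) := by
    rintro P ⟨f, hfe, hP, hno⟩
    rw [← ends_index e, ← ends_index f] at hno
    exact ((meet (index_injective.ne hfe.symm) hP.1 hP.2).resolve_left hno).2
  exact Set.encard_le_one_iff.2 fun P Q hP hQ => (hsub P hP).trans (hsub Q hQ).symm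

theorem Mates.crossings_nonempty {e f : Edge m} (h : Mates e f) :
    ((columnDrawing m).crossings ⟨ends e, ends_mem_edgeSet e⟩).Nonempty := by
  have hne : f ≠ e := by
    rintro rfl
    exact h.disjoint (Sym2.mem_mk_left _ _) (Sym2.mem_mk_left _ _)
  refine ⟨crossPoint e, ⟨ends f, ends_mem_edgeSet f⟩,
    fun hef => hne (ends_injective (congrArg Subtype.val hef)), ?_, ?_⟩
  · have hmem := h.crossPoint_mem
    change _ ∈ edgeCurve (index _) ∩ edgeCurve (index _)
    rwa [index_ends, index_ends]
  · rintro ⟨w, he, hf, -⟩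
    exact h.disjoint he hf

/-! ### Saturation -/

/-- A point of the open strip on an edge that is crossed. -/
theorem exists_crossed_of_mem {i : Fin m} {a b : Link} (hab : a.mate = some b) {t y : ℝ}
    (hy : y ^ 2 < 1) (ht : t = offset (some (i, a)) + a.slope * y)
    (h1 : level (bot (some (i, a))) ≤ y) (h2 : y ≤ level (top (some (i, a)))) :
    ∃ e, ((columnDrawing m).crossings e).Nonempty ∧ strip t y ∈ (columnDrawing m).curve e := by
  refine ⟨⟨ends (some (i, a)), ends_mem_edgeSet _⟩,
    Mates.crossings_nonempty ⟨i, a, b, rfl, rfl, hab⟩, ?_⟩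
  change _ ∈ edgeCurve (index _)
  rw [index_ends]
  exact (strip_mem_stripSegment hy).2 ⟨ht, h1, h2⟩

/-- The left boundary of column `i`: down the edge from the north pole to the center as far as its
crossing, then down the edge from the upper vertex to the south pole. -/
noncomputable def leftBound (i : Fin m) (y : ℝ) : ℝ := 4 * (i : ℕ) + min (-y) (y - 1 / 2)

/-- The right boundary of column `i`: down the edge from the north pole to the lower vertex as far
as its crossing, then down the edge from the center to the south pole. -/
noncomputable def rightBound (i : Fin m) (y : ℝ) : ℝ := 4 * (i : ℕ) + max (-y) (y + 1 / 2)

theorem continuous_leftBound (i : Fin m) : Continuous (leftBound i) := by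
  unfold leftBound; fun_prop

theorem continuous_rightBound (i : Fin m) : Continuous (rightBound i) := by
  unfold rightBound; fun_prop

theorem exists_crossed_leftBound (i : Fin m) {y : ℝ} (hy : y ^ 2 < 1) :
    ∃ e, ((columnDrawing m).crossings e).Nonempty ∧
      strip (leftBound i y) y ∈ (columnDrawing m).curve e := by
  have hy1 : -1 ≤ y := by nlinarith
  have hy2 : y ≤ 1 := by nlinarith
  rcases le_total (-y) (y - 1 / 2) with h | h
  · refine exists_crossed_of_mem (i := i) (a := .centerNorth) rfl hy ?_ ?_ ?_
    · rw [leftBound, min_eq_left h]; simp [offset, Link.shift, Link.slope]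
    · simp only [bot, level]; linarith
    · simpa only [top, level] using hy2
  · refine exists_crossed_of_mem (i := i) (a := .upperSouth) rfl hy ?_ ?_ ?_
    · rw [leftBound, min_eq_right h]; simp only [offset, Link.shift, Link.slope]; ring
    · simpa only [bot, level] using hy1
    · simp only [top, level]; linarith

theorem exists_crossed_rightBound (i : Fin m) {y : ℝ} (hy : y ^ 2 < 1) :
    ∃ e, ((columnDrawing m).crossings e).Nonempty ∧
      strip (rightBound i y) y ∈ (columnDrawing m).curve e := by
  have hy1 : -1 ≤ y := by nlinarith
  have hy2 : y ≤ 1 := by nlinarith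
  rcases le_total (-y) (y + 1 / 2) with h | h
  · refine exists_crossed_of_mem (i := i) (a := .lowerNorth) rfl hy ?_ ?_ ?_
    · rw [rightBound, max_eq_right h]; simp only [offset, Link.shift, Link.slope]; ring
    · simp only [bot, level]; linarith
    · simpa only [top, level] using hy2
  · refine exists_crossed_of_mem (i := i) (a := .centerSouth) rfl hy ?_ ?_ ?_
    · rw [rightBound, max_eq_left h]; simp [offset, Link.shift, Link.slope]
    · simpa only [bot, level] using hy1
    · simp only [top, level]; linarith

/-- If the bounding graphs of a strip region run along crossed edges, and the region separates two
vertices that are not poles, then these vertices cannot be joined. -/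
theorem not_exists_extends_of_region {a b : ℝ → ℝ} (ha : Continuous a) (hb : Continuous b)
    (hfr : ∀ t y, y ^ 2 < 1 → a y ≤ t → t ≤ b y → t = a y ∨ t = b y →
      ∃ e, ((columnDrawing m).crossings e).Nonempty ∧ strip t y ∈ (columnDrawing m).curve e)
    {u v : Fin m × Spot} (hG : ¬ (columnGraph m).Adj (.inr u) (.inr v))
    (hu1 : a (level (.inr u : Vertex m)) < abscissa (.inr u : Vertex m))
    (hu2 : abscissa (.inr u : Vertex m) < b (level (.inr u : Vertex m)))
    (hv : abscissa (.inr v : Vertex m) < a (level (.inr v : Vertex m)) ∨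
      b (level (.inr v : Vertex m)) < abscissa (.inr v : Vertex m)) :
    ¬ ∃ Γ' : GoodDrawing (columnGraph m ⊔ SimpleGraph.edge (.inr u) (.inr v)),
      Γ'.Extends (columnDrawing m) ∧ Γ'.IsKPlanar 1 := by
  have hmem : vertexPoint (.inr u : Vertex m) ∈ stripRegion a b :=
    strip_mem_stripRegion (level_inr_sq_lt_one u) hu1 hu2
  have hnot : vertexPoint (.inr v : Vertex m) ∉ closure (stripRegion a b) :=
    strip_notMem_closure_stripRegion ha hb (level_inr_sq_lt_one v) hv
  refine GoodDrawing.not_exists_extends_of_frontier ?_ hG (isOpen_stripRegion ha hb) hmem hnot ?_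
  · rintro h
    rw [h] at hmem
    exact hnot (subset_closure hmem)
  · intro P hP
    rcases frontier_stripRegion ha hb hP with rfl | rfl | ⟨t, y, rfl, hy, h1, h2, h⟩
    · exact .inl ⟨.inl true, by simp [columnDrawing, vertexPoint, strip, level]⟩
    · exact .inl ⟨.inl false, by simp [columnDrawing, vertexPoint, strip, level]⟩
    · exact .inr (hfr t y hy h1 h2 h)

/-- A vertex of a column other than the gap vertex cannot be joined to a vertex outside. -/
theorem not_exists_extends_column {i : Fin m} {s : Spot} (hs : s ≠ .gap) {v : Fin m × Spot}
    (hv : v.1 ≠ i ∨ v.2 = .gap) (hG : ¬ (columnGraph m).Adj (.inr (i, s)) (.inr v)) :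
    ¬ ∃ Γ' : GoodDrawing (columnGraph m ⊔ SimpleGraph.edge (.inr (i, s)) (.inr v)),
      Γ'.Extends (columnDrawing m) ∧ Γ'.IsKPlanar 1 := by
  refine not_exists_extends_of_region (continuous_leftBound i) (continuous_rightBound i)
    ?_ hG ?_ ?_ ?_
  · rintro t y hy - - (rfl | rfl)
    exacts [exists_crossed_leftBound i hy, exists_crossed_rightBound i hy]
  · cases s <;> first | exact absurd rfl hs | norm_num [leftBound, level, abscissa, Spot.shift]
  · cases s <;> first | exact absurd rfl hs | norm_num [rightBound, level, abscissa, Spot.shift]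
  · obtain ⟨j, r⟩ := v
    rcases lt_trichotomy j i with h | rfl | h
    · left
      have h' : ((j : ℕ) : ℝ) + 1 ≤ (i : ℕ) := by exact_mod_cast h
      cases r <;> norm_num [leftBound, level, abscissa, Spot.shift] <;> linarith
    · right
      obtain rfl : r = .gap := hv.resolve_left fun h => h rfl
      norm_num [rightBound, level, abscissa, Spot.shift]
    · right
      have h' : ((i : ℕ) : ℝ) + 1 ≤ (j : ℕ) := by exact_mod_cast h
      cases r <;> norm_num [rightBound, level, abscissa, Spot.shift] <;> linarith

/-- The upper and the lower vertex of a column cannot be joined: the triangle between the north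
pole, the center and the right crossing contains only the former. -/
theorem not_exists_extends_upper_lower (i : Fin m)
    (hG : ¬ (columnGraph m).Adj (.inr (i, .upper)) (.inr (i, .lower))) :
    ¬ ∃ Γ' : GoodDrawing (columnGraph m ⊔ SimpleGraph.edge (.inr (i, .upper)) (.inr (i, .lower))),
      Γ'.Extends (columnDrawing m) ∧ Γ'.IsKPlanar 1 := by
  refine not_exists_extends_of_region (a := fun y => 4 * (i : ℕ) - y)
    (b := fun y => 4 * (i : ℕ) + y + 1 / 2) (by fun_prop) (by fun_prop) ?_ hG ?_ ?_ ?_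
  · intro t y hy h1 h2 h
    have hy1 : -1 ≤ y := by nlinarith
    have hy2 : y ≤ 1 := by nlinarith
    rcases h with rfl | rfl
    · rcases le_total 0 y with h0 | h0
      · refine exists_crossed_of_mem (i := i) (a := .centerNorth) rfl hy ?_ ?_ ?_
        · simp only [offset, Link.shift, Link.slope]; ring
        · simpa only [bot, level] using h0
        · simpa only [top, level] using hy2
      · refine exists_crossed_of_mem (i := i) (a := .centerSouth) rfl hy ?_ ?_ ?_
        · simp only [offset, Link.shift, Link.slope]; ring
        · simpa only [bot, level] using hy1
        · simpa only [top, level] using h0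
    · refine exists_crossed_of_mem (i := i) (a := .lowerNorth) rfl hy ?_ ?_ ?_
      · simp only [offset, Link.shift, Link.slope]; ring
      · simp only [bot, level]; linarith
      · simpa only [top, level] using hy2
  · norm_num [level, abscissa, Spot.shift]
  · simp only [level, abscissa, Spot.shift]; linarith
  · left
    norm_num [level, abscissa, Spot.shift]

/-- Two gap vertices cannot be joined: between two columns there are only the gap vertices of these
and of the columns in between. -/
theorem not_exists_extends_gap {i j : Fin m} (hij : i < j)
    (hG : ¬ (columnGraph m).Adj (.inr (i, .gap)) (.inr (j, .gap))) :
    ¬ ∃ Γ' : GoodDrawing (columnGraph m ⊔ SimpleGraph.edge (.inr (i, .gap)) (.inr (j, .gap))),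
      Γ'.Extends (columnDrawing m) ∧ Γ'.IsKPlanar 1 := by
  have h' : ((i : ℕ) : ℝ) + 1 ≤ (j : ℕ) := by exact_mod_cast hij
  refine not_exists_extends_of_region (continuous_rightBound i) (continuous_leftBound j)
    ?_ hG ?_ ?_ ?_
  · rintro t y hy - - (rfl | rfl)
    exacts [exists_crossed_rightBound i hy, exists_crossed_leftBound j hy]
  · norm_num [rightBound, level, abscissa, Spot.shift]
  · norm_num [leftBound, level, abscissa, Spot.shift]; linarith
  · right
    norm_num [leftBound, level, abscissa, Spot.shift]

/-- The poles are adjacent to all other vertices. -/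
theorem adj_pole {b : Bool} {w : Vertex m} (h : .inl b ≠ w) : (columnGraph m).Adj (.inl b) w := by
  rcases b with _ | _ <;> rcases w with (_ | _) | ⟨i, _ | _ | _ | _⟩
  · exact absurd rfl h
  · exact adj_of_ends none
  · exact adj_of_ends (some (i, .centerSouth))
  · exact adj_of_ends (some (i, .upperSouth))
  · exact adj_of_ends (some (i, .lowerSouth))
  · exact adj_of_ends (some (i, .gapSouth))
  · exact (adj_of_ends none).symm
  · exact absurd rfl h
  · exact (adj_of_ends (some (i, .centerNorth))).symm
  · exact (adj_of_ends (some (i, .upperNorth))).symm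
  · exact (adj_of_ends (some (i, .lowerNorth))).symm
  · exact (adj_of_ends (some (i, .gapNorth))).symm

theorem columnDrawing_isSimpleSaturated (m : ℕ) : (columnDrawing m).IsSimpleSaturated := by
  refine ⟨columnDrawing_isKPlanar m, ?_⟩
  intro u v huv hG
  rcases u with b | ⟨i, s⟩
  · exact absurd (adj_pole huv) hG
  rcases v with b | ⟨j, r⟩
  · exact absurd (adj_pole huv.symm).symm hG
  have hG' := fun h => hG (SimpleGraph.Adj.symm h)
  by_cases hs : s = .gap
  · by_cases hr : r = .gap
    · subst hs hr
      rcases lt_trichotomy i j with h | rfl | h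
      · exact not_exists_extends_gap h hG
      · exact absurd rfl huv
      · rw [SimpleGraph.edge_comm]
        exact not_exists_extends_gap h hG'
    · rw [SimpleGraph.edge_comm]
      exact not_exists_extends_column hr (.inr hs) hG'
  by_cases hr : r = .gap
  · exact not_exists_extends_column hs (.inr hr) hG
  by_cases hij : j = i
  · subst hij
    cases s <;> cases r <;> first
      | exact absurd rfl huv
      | exact absurd rfl hs
      | exact absurd rfl hr
      | exact absurd (adj_of_ends (some (j, .centerUpper))) hG
      | exact absurd (adj_of_ends (some (j, .centerUpper))) hG'
      | exact absurd (adj_of_ends (some (j, .lowerCenter))) hG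
      | exact absurd (adj_of_ends (some (j, .lowerCenter))) hG'
      | exact not_exists_extends_upper_lower j hG
      | (rw [SimpleGraph.edge_comm]; exact not_exists_extends_upper_lower j hG')
  · exact not_exists_extends_column hs (.inl hij) hG

/-! ### The matching number -/

/-- The poles and the centers form a vertex cover. -/
theorem matchingNumber_columnGraph_le (m : ℕ) : matchingNumber (columnGraph m) ≤ m + 2 := by
  let c : Bool ⊕ Fin m → Vertex m := Sum.map id fun i => (i, .center)
  refine (matchingNumber_le_of_cover (Set.range c) ?_).trans ?_
  · have hcov : ∀ e : Edge m, bot e ∈ Set.range c ∨ top e ∈ Set.range c := by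
      rintro (_ | ⟨i, a⟩)
      · exact .inl ⟨.inl false, rfl⟩
      · cases a <;> first
          | exact .inl ⟨.inl false, rfl⟩
          | exact .inr ⟨.inl true, rfl⟩
          | exact .inl ⟨.inr i, rfl⟩
          | exact .inr ⟨.inr i, rfl⟩
    intro u v huv
    obtain ⟨e, he⟩ := exists_ends_eq ⟨s(u, v), huv⟩
    rcases Sym2.eq_iff.1 he with ⟨rfl, rfl⟩ | ⟨rfl, rfl⟩
    exacts [hcov e, (hcov e).symm]
  · rw [← Set.image_univ]
    refine (Set.ncard_image_le Set.finite_univ).trans ?_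
    rw [Set.ncard_univ, Nat.card_eq_fintype_card]
    simp [add_comm]

theorem card_vertex (m : ℕ) : Fintype.card (Vertex m) = 4 * m + 2 := by
  have h4 : Fintype.card Spot = 4 := rfl
  simp [h4]
  ring

end OnePlanar

theorem mainTheorem8 (N : ℕ) :
    ∃ (V : Type) (_ : Fintype V) (G : SimpleGraph V) (Γ : OnePlanar.GoodDrawing G),
      N ≤ Fintype.card V ∧ Γ.IsSimpleSaturated ∧
        (OnePlanar.matchingNumber G : ℝ) ≤ ((Fintype.card V : ℝ) + 6) / 4 := by
  refine ⟨OnePlanar.Vertex N, inferInstance, OnePlanar.columnGraph N, OnePlanar.columnDrawing N,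
    ?_, OnePlanar.columnDrawing_isSimpleSaturated N, ?_⟩
  · rw [OnePlanar.card_vertex]; omega
  · have h : (OnePlanar.matchingNumber (OnePlanar.columnGraph N) : ℝ) ≤ N + 2 := by
      exact_mod_cast OnePlanar.matchingNumber_columnGraph_le N
    rw [OnePlanar.card_vertex]
    push_cast
    linarith
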